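/- A Hardy field is a subfield $H$ of the ring of germs at $+\infty$ of real-valued differentiable functions defined on intervals $(a,+\infty)$, $a\in\mathbb{R}$, such that $H$ is closed under differentiation. It is totally ordered by: $f\le g$ if and only if $f(t)\le g(t)$ for all sufficiently large $t$. A maximal Hardy field is one that is maximal under inclusion among all Hardy fields. For an ordered set $S$, let $\operatorname{cf}(S)$ and $\operatorname{ci}(S)$ denote its cofinality and its coinitiality (the cofinality of $S$ with the reversed ordering), and for $a\in S$ put $S^{<a}=\{s\in S: s<a\}$ and $S^{>a}=\{s\in S: s>a\}$. If $H$ is a maximal Hardy field, then $\operatorname{cf}(H)>\omega$, and $$\operatorname{ci}(H)\ =\ \operatorname{cf}(H^{<a})\ =\ \operatorname{ci}(H^{>a})\ >\ \omega\qquad\text{for all } a\in H.$$ -/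

import Mathlib

open Filter Topology Cardinal

/-- The ring of germs at `+∞` of real valued functions (any function on an interval `(a, +∞)`
has the same germ as a function defined on all of `ℝ`). The relation `f ≤ g` on it
means `f t ≤ g t` for all sufficiently large `t`. -/
abbrev GermsAtInfinity : Type := Germ (atTop : Filter ℝ) ℝ

/-- The germ `f` is the germ of a function that is differentiable on some interval `(a, +∞)`,
and `f'` is the germ of the derivative of that function. -/
def GermHasDeriv (f f' : GermsAtInfinity) : Prop :=
  ∃ g g' : ℝ → ℝ, f = (g : GermsAtInfinity) ∧ f' = (g' : GermsAtInfinity) ∧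
    ∀ᶠ t in atTop, HasDerivAt g (g' t) t

/-- A Hardy field: a subfield of the ring of germs at `+∞` of differentiable real valued
functions (that is, a subring that happens to be a field) which is closed under
differentiation. -/
structure IsHardyField (H : Subring GermsAtInfinity) : Prop where
  isField : IsField H
  exists_deriv : ∀ f ∈ H, ∃ f' ∈ H, GermHasDeriv f f'

/-- The coinitiality of an ordered set: the cofinality of the set with the reversed order. -/
noncomputable def coinitiality (S : Type*) [Preorder S] : Cardinal :=
  Order.cof Sᵒᵈ

/-! Negation, translation and inversion are order isomorphisms or anti-isomorphisms that turn each
of the coinitialities and cofinalities in question into the cofinality of `H`, so it is enough to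
show that no countable subset of `H` is cofinal.

Given a countable cofinal subset, one builds functions `y 0, y 1, …`, all above `H`, such that `y (k
+ 1)` is the logarithmic derivative of `y k` and `y k` exceeds every power of `y (k + 1)`
(`exists_chain_dominating`, `eventually_chain_succ_pow_le`). The ring generated over `H` by all `y
k` is closed under differentiation. Each of its nonzero elements lies eventually, in absolute value,
between a negative and a positive power of `y 0`, hence is a unit
(`nonzeroComparable_adjoinSegment`). Its fractions form a Hardy field
(`exists_isHardyField_of_logDeriv_chain`). Maximality puts `y 0` into `H`, so that `y 0 + 1 ≤ y 0`,
which is absurd. -/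

/-! ### Germs comparable to powers of a function. -/

/-- The germ of `f` lies eventually between `c⁻ᵐ` and `cᵐ` in absolute value, for some `m`. -/
def ComparableToPowers (c : ℝ → ℝ) (f : GermsAtInfinity) : Prop :=
  ∃ g : ℝ → ℝ, f = (g : GermsAtInfinity) ∧
    ∃ m : ℕ, ∀ᶠ t in atTop, 1 ≤ |g t| * c t ^ m ∧ |g t| ≤ c t ^ m

/-- Every nonzero element of `S` is comparable to a power of `c`. -/
def NonzeroComparable (c : ℝ → ℝ) (S : Subring GermsAtInfinity) : Prop :=
  ∀ f ∈ S, f ≠ 0 → ComparableToPowers c f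

theorem ComparableToPowers.mul_inv_cancel {c : ℝ → ℝ} {f : GermsAtInfinity}
    (h : ComparableToPowers c f) : f * f⁻¹ = 1 := by
  obtain ⟨g, rfl, m, hg⟩ := h
  rw [← Germ.coe_inv, ← Germ.coe_mul, ← Germ.coe_one]
  refine Germ.coe_eq.2 (hg.mono fun t ht => mul_inv_cancel₀ fun h0 => ?_)
  have := ht.1
  rw [h0] at this
  norm_num at this

theorem mul_pow_le_mul_pow_of_le {x c : ℝ} {m n : ℕ} (hc : 1 ≤ c) (hmn : m ≤ n) :
    |x| * c ^ m ≤ |x| * c ^ n :=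
  mul_le_mul_of_nonneg_left (pow_le_pow_right₀ hc hmn) (abs_nonneg x)

/-- The product `q * y` wins over `a`, since `|q| ≥ c⁻ᵐ`, `|a| ≤ cᵏ` and `y ≥ c^(k+m+1)`. The lower
bound is kept in powers of `c`, not of `y`: only then does multiplication by `y` win again in the
next Horner step. -/
theorem ComparableToPowers.horner {c y : ℝ → ℝ} (hc : ∀ᶠ t in atTop, 2 ≤ c t)
    (hy : ∀ m : ℕ, ∀ᶠ t in atTop, c t ^ m ≤ y t) {a q : ℝ → ℝ} {k m : ℕ}
    (ha : ∀ᶠ t in atTop, |a t| ≤ c t ^ k)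
    (hq : ∀ᶠ t in atTop, 1 ≤ |q t| * c t ^ m ∧ |q t| ≤ y t ^ m) :
    ∀ᶠ t in atTop, 1 ≤ |q t * y t + a t| * c t ^ m ∧ |q t * y t + a t| ≤ y t ^ (m + 2) := by
  filter_upwards [hc, hy (k + m + 1), hy 1, hy k, ha, hq] with t hc h1 h2 h3 ha hq
  have hy2 : 2 ≤ y t := hc.trans (by simpa using h2)
  have hcm : 0 < c t ^ m := by positivity
  have habs : |q t * y t| = |q t| * y t := by
    rw [abs_mul, abs_of_nonneg (by linarith : 0 ≤ y t)]
  constructor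
  · have e1 : |q t| * y t - c t ^ k ≤ |q t * y t + a t| := by
      have := abs_sub_abs_le_abs_sub (q t * y t) (-a t)
      rw [abs_neg, sub_neg_eq_add, habs] at this
      linarith
    have e2 : y t ≤ |q t| * c t ^ m * y t := le_mul_of_one_le_left (by linarith) hq.1
    have e3 : 1 ≤ c t ^ (k + m) := one_le_pow₀ (by linarith)
    have e4 : 2 * c t ^ (k + m) ≤ c t ^ (k + m + 1) := by
      rw [pow_succ, mul_comm]
      exact mul_le_mul_of_nonneg_left hc (by linarith)
    calc (1 : ℝ) ≤ y t - c t ^ (k + m) := by linarith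
      _ ≤ |q t| * c t ^ m * y t - c t ^ (k + m) := by linarith
      _ = (|q t| * y t - c t ^ k) * c t ^ m := by rw [pow_add]; ring
      _ ≤ _ := mul_le_mul_of_nonneg_right e1 hcm.le
  · have e5 : y t ≤ y t ^ (m + 1) := le_self_pow₀ (by linarith) (by omega)
    calc |q t * y t + a t| ≤ |q t| * y t + |a t| := by rw [← habs]; exact abs_add_le _ _
      _ ≤ y t ^ m * y t + y t := by
        gcongr
        · exact hq.2
        · exact ha.trans h3
      _ ≤ y t ^ (m + 1) * 2 := by rw [← pow_succ]; linarith
      _ ≤ y t ^ (m + 1) * y t := by gcongr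
      _ = y t ^ (m + 2) := by ring

/-- Polynomials in `y` over a ring `S` whose elements are comparable to powers of `c`, where `y`
dominates all powers of `c`. -/
theorem eval₂_comparable {c y : ℝ → ℝ} {S : Subring GermsAtInfinity}
    (hc : ∀ᶠ t in atTop, 2 ≤ c t) (hy : ∀ m : ℕ, ∀ᶠ t in atTop, c t ^ m ≤ y t)
    (hS : NonzeroComparable c S) (n : ℕ) :
    ∀ p : Polynomial S, p.natDegree ≤ n →
      p.eval₂ S.subtype (y : GermsAtInfinity) = 0 ∨
      ∃ g : ℝ → ℝ, p.eval₂ S.subtype (y : GermsAtInfinity) = (g : GermsAtInfinity) ∧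
        ∃ m : ℕ, ∀ᶠ t in atTop, 1 ≤ |g t| * c t ^ m ∧ |g t| ≤ y t ^ m := by
  have const : ∀ a : S, (a : GermsAtInfinity) = 0 ∨
      ∃ g : ℝ → ℝ, (a : GermsAtInfinity) = (g : GermsAtInfinity) ∧
        ∃ m : ℕ, ∀ᶠ t in atTop, 1 ≤ |g t| * c t ^ m ∧ |g t| ≤ y t ^ m := by
    intro a
    by_cases ha : (a : GermsAtInfinity) = 0
    · exact .inl ha
    · obtain ⟨g, hg, m, hm⟩ := hS a a.2 ha
      refine .inr ⟨g, hg, m, ?_⟩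
      filter_upwards [hm, hc, hy 1] with t h1 h2 h3
      exact ⟨h1.1, h1.2.trans (pow_le_pow_left₀ (by linarith) (by simpa using h3) _)⟩
  induction n with
  | zero =>
    intro p hp
    rw [Polynomial.eq_C_of_natDegree_le_zero hp, Polynomial.eval₂_C]
    exact const _
  | succ n ih =>
    intro p hp
    have hdiv : p.divX.natDegree ≤ n := by
      rw [Polynomial.natDegree_divX_eq_natDegree_tsub_one]; omega
    have hev : p.eval₂ S.subtype (y : GermsAtInfinity) =
        p.divX.eval₂ S.subtype (y : GermsAtInfinity) * y + (p.coeff 0 : GermsAtInfinity) := by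
      conv_lhs => rw [← Polynomial.divX_mul_X_add p]
      simp [Polynomial.eval₂_add, Polynomial.eval₂_C]
    -- If the Horner quotient vanishes as a germ, only the constant coefficient remains; so `y` need
    -- not be known to be transcendental over `S`.
    rcases ih p.divX hdiv with h0 | ⟨q, hq, m, hm⟩
    · rw [hev, h0, zero_mul, zero_add]
      exact const _
    · have ha : ∃ a : ℝ → ℝ, (p.coeff 0 : GermsAtInfinity) = (a : GermsAtInfinity) ∧
          ∃ k : ℕ, ∀ᶠ t in atTop, |a t| ≤ c t ^ k := by
        by_cases ha : (p.coeff 0 : GermsAtInfinity) = 0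
        · exact ⟨0, by rw [ha]; rfl, 0, by simp⟩
        · obtain ⟨g, hg, m, hm⟩ := hS _ (p.coeff 0).2 ha
          exact ⟨g, hg, m, hm.mono fun t h => h.2⟩
      obtain ⟨a, ha, k, hk⟩ := ha
      refine .inr ⟨fun t => q t * y t + a t, ?_, m + 2, ?_⟩
      · rw [hev, hq, ha]; rfl
      · filter_upwards [ComparableToPowers.horner hc hy hk hm, hc] with t h1 h2
        exact ⟨h1.1.trans (mul_pow_le_mul_pow_of_le (by linarith) (by omega)), h1.2⟩

theorem exists_eval₂_of_mem_closure_insert {S : Subring GermsAtInfinity} {y f : GermsAtInfinity}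
    (hf : f ∈ Subring.closure (insert y (S : Set GermsAtInfinity))) :
    ∃ p : Polynomial S, f = p.eval₂ S.subtype y := by
  induction hf using Subring.closure_induction with
  | mem x hx =>
    rcases hx with rfl | hx
    · exact ⟨Polynomial.X, by simp⟩
    · exact ⟨Polynomial.C ⟨x, hx⟩, by simp⟩
  | zero => exact ⟨0, by simp⟩
  | one => exact ⟨1, by simp⟩
  | add x y _ _ hx hy =>
    obtain ⟨p, rfl⟩ := hx
    obtain ⟨q, rfl⟩ := hy
    exact ⟨p + q, by simp [Polynomial.eval₂_add]⟩
  | neg x _ hx =>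
    obtain ⟨p, rfl⟩ := hx
    exact ⟨-p, by simp [Polynomial.eval₂_neg]⟩
  | mul x y _ _ hx hy =>
    obtain ⟨p, rfl⟩ := hx
    obtain ⟨q, rfl⟩ := hy
    exact ⟨p * q, by simp [Polynomial.eval₂_mul]⟩

theorem NonzeroComparable.closure_insert {c y : ℝ → ℝ} {S : Subring GermsAtInfinity}
    (hc : ∀ᶠ t in atTop, 2 ≤ c t) (hy : ∀ m : ℕ, ∀ᶠ t in atTop, c t ^ m ≤ y t)
    (hS : NonzeroComparable c S) :
    NonzeroComparable y
      (Subring.closure (insert (y : GermsAtInfinity) (S : Set GermsAtInfinity))) := by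
  intro f hf h0
  obtain ⟨p, rfl⟩ := exists_eval₂_of_mem_closure_insert hf
  obtain ⟨g, hg, m, hm⟩ := (eval₂_comparable hc hy hS _ p le_rfl).resolve_left h0
  refine ⟨g, hg, m, ?_⟩
  filter_upwards [hm, hc, hy 1] with t h1 h2 h3
  exact ⟨h1.1.trans (mul_le_mul_of_nonneg_left
    (pow_le_pow_left₀ (by linarith) (by simpa using h3) _) (abs_nonneg _)), h1.2⟩

/-! ### Adjoining a chain of functions. -/

/-- The ring generated over `H` by `y k, …, y (k + n - 1)`. -/
def adjoinSegment (H : Subring GermsAtInfinity) (y : ℕ → ℝ → ℝ) : ℕ → ℕ → Subring GermsAtInfinity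
  | 0, _ => H
  | n + 1, k => Subring.closure
      (insert (y k : GermsAtInfinity) (adjoinSegment H y n (k + 1) : Set GermsAtInfinity))

theorem mem_adjoinSegment_of_mem {H : Subring GermsAtInfinity} (y : ℕ → ℝ → ℝ)
    {f : GermsAtInfinity} (hf : f ∈ H) (n : ℕ) : ∀ k, f ∈ adjoinSegment H y n k := by
  induction n with
  | zero => exact fun _ => hf
  | succ n ih => exact fun k => Subring.subset_closure (.inr (ih (k + 1)))

theorem apply_mem_adjoinSegment (H : Subring GermsAtInfinity) (y : ℕ → ℝ → ℝ) (n : ℕ) :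
    ∀ k i, i < n → (y (k + i) : GermsAtInfinity) ∈ adjoinSegment H y n k := by
  induction n with
  | zero => intro k i h; omega
  | succ n ih =>
    intro k i h
    rcases i with _ | i
    · exact Subring.subset_closure (.inl rfl)
    · refine Subring.subset_closure (.inr ?_)
      have := ih (k + 1) i (by omega)
      rwa [add_right_comm] at this

theorem adjoinSegment_mono_succ (H : Subring GermsAtInfinity) (y : ℕ → ℝ → ℝ) (n : ℕ) :
    ∀ k, adjoinSegment H y n k ≤ adjoinSegment H y (n + 1) k := by
  induction n with
  | zero => exact fun k f hf => mem_adjoinSegment_of_mem y hf 1 k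
  | succ n ih => exact fun k => Subring.closure_mono (Set.insert_subset_insert (ih (k + 1)))

theorem exists_mem_adjoinSegment {H : Subring GermsAtInfinity} {y : ℕ → ℝ → ℝ}
    {f : GermsAtInfinity}
    (hf : f ∈ Subring.closure ((H : Set GermsAtInfinity) ∪
      Set.range fun k => (y k : GermsAtInfinity))) :
    ∃ n, f ∈ adjoinSegment H y n 0 := by
  have hmono : Monotone fun n => adjoinSegment H y n 0 :=
    monotone_nat_of_le_succ fun n => adjoinSegment_mono_succ H y n 0
  induction hf using Subring.closure_induction with
  | mem x hx =>
    rcases hx with hx | ⟨k, rfl⟩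
    · exact ⟨0, hx⟩
    · exact ⟨k + 1, by simpa using apply_mem_adjoinSegment H y (k + 1) 0 k (by omega)⟩
  | zero => exact ⟨0, zero_mem _⟩
  | one => exact ⟨0, one_mem _⟩
  | add x y _ _ hx hy =>
    obtain ⟨m, hm⟩ := hx
    obtain ⟨n, hn⟩ := hy
    exact ⟨max m n, add_mem (hmono (le_max_left _ _) hm) (hmono (le_max_right _ _) hn)⟩
  | neg x _ hx =>
    obtain ⟨m, hm⟩ := hx
    exact ⟨m, neg_mem hm⟩
  | mul x y _ _ hx hy =>
    obtain ⟨m, hm⟩ := hx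
    obtain ⟨n, hn⟩ := hy
    exact ⟨max m n, mul_mem (hmono (le_max_left _ _) hm) (hmono (le_max_right _ _) hn)⟩

/-- Generators are adjoined from the largest index down: what is already there is controlled by
powers of `y (k + 1)`, and the new `y k` dominates these. -/
theorem nonzeroComparable_adjoinSegment {H : Subring GermsAtInfinity} {y : ℕ → ℝ → ℝ}
    (h2 : ∀ k, ∀ᶠ t in atTop, 2 ≤ y k t)
    (hpow : ∀ k (m : ℕ), ∀ᶠ t in atTop, y (k + 1) t ^ m ≤ y k t)
    (hH : ∀ k, NonzeroComparable (y k) H) (n : ℕ) :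
    ∀ k, NonzeroComparable (y k) (adjoinSegment H y n k) := by
  induction n with
  | zero => exact hH
  | succ n ih => exact fun k => (ih (k + 1)).closure_insert (h2 (k + 1)) (hpow k)

/-- An element of a field of germs with all elements bounded by `c` is comparable to `c`. -/
theorem nonzeroComparable_of_isField {H : Subring GermsAtInfinity} (hH : IsField H) {c : ℝ → ℝ}
    (hc : ∀ f ∈ H, f ≤ (c : GermsAtInfinity)) : NonzeroComparable c H := by
  have key : ∀ g : ℝ → ℝ, (g : GermsAtInfinity) ∈ H → ∀ᶠ t in atTop, |g t| ≤ c t := by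
    intro g hg
    have h1 := Germ.coe_le.1 (hc _ hg)
    have h2 := Germ.coe_le.1 ((Germ.coe_neg g).trans_le (hc _ (neg_mem hg)))
    filter_upwards [h1, h2] with t h1 h2
    exact abs_le'.2 ⟨h1, h2⟩
  intro f hf h0
  -- The inverse of `f` also lies in `H`; its upper bound `c` is the lower bound for `f`.
  obtain ⟨⟨b, hb⟩, hfb⟩ := hH.mul_inv_cancel (a := ⟨f, hf⟩) (by simpa [Subtype.ext_iff] using h0)
  replace hfb : f * b = 1 := congrArg Subtype.val hfb
  induction f using Germ.inductionOn with | _ f => ?_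
  induction b using Germ.inductionOn with | _ b => ?_
  refine ⟨f, rfl, 1, ?_⟩
  rw [← Germ.coe_mul, ← Germ.coe_one, Germ.coe_eq] at hfb
  filter_upwards [key f hf, key b hb, hfb] with t h1 h2 h3
  rw [pow_one]
  refine ⟨?_, h1⟩
  replace h3 : f t * b t = 1 := h3
  rw [← abs_one, ← h3, abs_mul]
  exact mul_le_mul_of_nonneg_left h2 (abs_nonneg _)

/-! ### Derivatives and fractions of germs. -/

theorem GermHasDeriv.add {f f' g g' : GermsAtInfinity} (hf : GermHasDeriv f f')
    (hg : GermHasDeriv g g') : GermHasDeriv (f + g) (f' + g') := by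
  obtain ⟨a, a', rfl, rfl, ha⟩ := hf
  obtain ⟨b, b', rfl, rfl, hb⟩ := hg
  exact ⟨a + b, a' + b', rfl, rfl, by filter_upwards [ha, hb] with t h1 h2 using h1.add h2⟩

theorem GermHasDeriv.neg {f f' : GermsAtInfinity} (hf : GermHasDeriv f f') :
    GermHasDeriv (-f) (-f') := by
  obtain ⟨a, a', rfl, rfl, ha⟩ := hf
  exact ⟨-a, -a', rfl, rfl, by filter_upwards [ha] with t h1 using h1.neg⟩

theorem GermHasDeriv.mul {f f' g g' : GermsAtInfinity} (hf : GermHasDeriv f f')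
    (hg : GermHasDeriv g g') : GermHasDeriv (f * g) (f' * g + f * g') := by
  obtain ⟨a, a', rfl, rfl, ha⟩ := hf
  obtain ⟨b, b', rfl, rfl, hb⟩ := hg
  exact ⟨a * b, a' * b + a * b', rfl, rfl,
    by filter_upwards [ha, hb] with t h1 h2 using h1.mul h2⟩

theorem germHasDeriv_const (r : ℝ) : GermHasDeriv ((fun _ => r : ℝ → ℝ) : GermsAtInfinity) 0 :=
  ⟨fun _ => r, 0, rfl, rfl, .of_forall fun t => hasDerivAt_const t r⟩

/-- Inversion of germs is pointwise with `0⁻¹ = 0`, so `f * f⁻¹ = 1` says that `f` is eventually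
nonzero. -/
theorem GermHasDeriv.inv {f f' : GermsAtInfinity} (hf : GermHasDeriv f f') (h0 : f * f⁻¹ = 1) :
    GermHasDeriv f⁻¹ (-f' * (f * f)⁻¹) := by
  obtain ⟨a, a', rfl, rfl, ha⟩ := hf
  rw [← Germ.coe_inv, ← Germ.coe_mul, ← Germ.coe_one, Germ.coe_eq] at h0
  refine ⟨a⁻¹, -a' * (a * a)⁻¹, rfl, rfl, ?_⟩
  filter_upwards [ha, h0] with t h1 h2
  have ht : a t ≠ 0 := by
    intro h
    simp [h] at h2
  have := h1.inv ht
  rwa [pow_two, div_eq_mul_inv] at this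

/-- The ring of fractions, inside the ring of germs, of a ring of germs all of whose nonzero
elements are units. -/
def fractionSubring (R : Subring GermsAtInfinity) (hR : ∀ f ∈ R, f ≠ 0 → f * f⁻¹ = 1) :
    Subring GermsAtInfinity where
  carrier := {f | ∃ a ∈ R, ∃ b ∈ R, b ≠ 0 ∧ f * b = a}
  zero_mem' := ⟨0, zero_mem R, 1, one_mem R, one_ne_zero, by simp⟩
  one_mem' := ⟨1, one_mem R, 1, one_mem R, one_ne_zero, by simp⟩
  neg_mem' := by
    rintro f ⟨a, ha, b, hb, h0, rfl⟩
    exact ⟨_, neg_mem ha, b, hb, h0, by ring⟩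
  add_mem' := by
    rintro f g ⟨a, ha, b, hb, h0, rfl⟩ ⟨c, hc, d, hd, h1, rfl⟩
    refine ⟨_, add_mem (mul_mem ha hd) (mul_mem hc hb), b * d, mul_mem hb hd, ?_, by ring⟩
    intro h
    apply h1
    calc d = (b * b⁻¹) * d := by rw [hR b hb h0, one_mul]
      _ = b⁻¹ * (b * d) := by ring
      _ = 0 := by rw [h, mul_zero]
  mul_mem' := by
    rintro f g ⟨a, ha, b, hb, h0, rfl⟩ ⟨c, hc, d, hd, h1, rfl⟩
    refine ⟨_, mul_mem ha hc, b * d, mul_mem hb hd, ?_, by ring⟩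
    intro h
    apply h1
    calc d = (b * b⁻¹) * d := by rw [hR b hb h0, one_mul]
      _ = b⁻¹ * (b * d) := by ring
      _ = 0 := by rw [h, mul_zero]

theorem le_fractionSubring {R : Subring GermsAtInfinity}
    (hR : ∀ f ∈ R, f ≠ 0 → f * f⁻¹ = 1) : R ≤ fractionSubring R hR :=
  fun f hf => ⟨f, hf, 1, one_mem R, one_ne_zero, mul_one f⟩

theorem inv_mem_fractionSubring {R : Subring GermsAtInfinity}
    (hR : ∀ f ∈ R, f ≠ 0 → f * f⁻¹ = 1) {b : GermsAtInfinity} (hb : b ∈ R) (h0 : b ≠ 0) :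
    b⁻¹ ∈ fractionSubring R hR :=
  ⟨1, one_mem R, b, hb, h0, by rw [mul_comm, hR b hb h0]⟩

theorem isHardyField_fractionSubring {R : Subring GermsAtInfinity}
    (hR : ∀ f ∈ R, f ≠ 0 → f * f⁻¹ = 1) (hd : ∀ f ∈ R, ∃ f' ∈ R, GermHasDeriv f f') :
    IsHardyField (fractionSubring R hR) := by
  refine ⟨⟨⟨0, 1, zero_ne_one⟩, mul_comm, ?_⟩, ?_⟩
  · rintro ⟨f, a, ha, b, hb, h0, rfl⟩ hf
    have hfb : f * b ≠ 0 := by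
      intro h
      apply hf
      refine Subtype.ext ?_
      calc f = f * (b * b⁻¹) := by rw [hR b hb h0, mul_one]
        _ = f * b * b⁻¹ := by ring
        _ = 0 := by rw [h, zero_mul]
    refine ⟨⟨b * (f * b)⁻¹, mul_mem (le_fractionSubring hR hb)
      (inv_mem_fractionSubring hR ha hfb)⟩, Subtype.ext ?_⟩
    change f * (b * (f * b)⁻¹) = 1
    rw [← mul_assoc, hR _ ha hfb]
  · rintro f ⟨a, ha, b, hb, h0, rfl⟩
    obtain ⟨a', ha', had⟩ := hd _ ha
    obtain ⟨b', hb', hbd⟩ := hd _ hb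
    have hbb : b * b ≠ 0 := by
      intro h
      apply h0
      calc b = (b * b⁻¹) * b := by rw [hR b hb h0, one_mul]
        _ = b⁻¹ * (b * b) := by ring
        _ = 0 := by rw [h, mul_zero]
    have hf : f = f * b * b⁻¹ := by rw [mul_assoc, hR b hb h0, mul_one]
    have hder := had.mul (hbd.inv (hR b hb h0))
    rw [← hf] at hder
    have hle := le_fractionSubring hR
    exact ⟨_, add_mem (mul_mem (hle ha') (inv_mem_fractionSubring hR hb h0))
      (mul_mem (hle ha) (mul_mem (neg_mem (hle hb'))
        (inv_mem_fractionSubring hR (mul_mem hb hb) hbb))), hder⟩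

theorem exists_deriv_mem_closure {s : Set GermsAtInfinity}
    (hs : ∀ f ∈ s, ∃ f' ∈ Subring.closure s, GermHasDeriv f f') :
    ∀ f ∈ Subring.closure s, ∃ f' ∈ Subring.closure s, GermHasDeriv f f' := by
  intro f hf
  induction hf using Subring.closure_induction with
  | mem x hx => exact hs x hx
  | zero => exact ⟨0, zero_mem _, germHasDeriv_const 0⟩
  | one => exact ⟨0, zero_mem _, germHasDeriv_const 1⟩
  | add x y _ _ hx hy =>
    obtain ⟨x', hx', hxd⟩ := hx
    obtain ⟨y', hy', hyd⟩ := hy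
    exact ⟨_, add_mem hx' hy', hxd.add hyd⟩
  | neg x _ hx =>
    obtain ⟨x', hx', hxd⟩ := hx
    exact ⟨_, neg_mem hx', hxd.neg⟩
  | mul x y hxm hym hx hy =>
    obtain ⟨x', hx', hxd⟩ := hx
    obtain ⟨y', hy', hyd⟩ := hy
    exact ⟨_, add_mem (mul_mem hx' hym) (mul_mem hxm hy'), hxd.mul hyd⟩

/-- A Hardy field `H` extends to one containing all `y k`, if `y 0, y 1, …` are above all
elements of `H`, each is the logarithmic derivative of the one before, and each dominates the
powers of the next. -/
theorem exists_isHardyField_of_logDeriv_chain {H : Subring GermsAtInfinity} (hH : IsHardyField H)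
    {y : ℕ → ℝ → ℝ} (h2 : ∀ k, ∀ᶠ t in atTop, 2 ≤ y k t)
    (hpow : ∀ k (m : ℕ), ∀ᶠ t in atTop, y (k + 1) t ^ m ≤ y k t)
    (hderiv : ∀ k, ∀ᶠ t in atTop, HasDerivAt (y k) (y k t * y (k + 1) t) t)
    (hle : ∀ k, ∀ f ∈ H, f ≤ (y k : GermsAtInfinity)) :
    ∃ K, IsHardyField K ∧ H ≤ K ∧ ∀ k, (y k : GermsAtInfinity) ∈ K := by
  set s : Set GermsAtInfinity :=
    (H : Set GermsAtInfinity) ∪ Set.range fun k => (y k : GermsAtInfinity) with hs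
  have hyR : ∀ k, (y k : GermsAtInfinity) ∈ Subring.closure s := fun k =>
    Subring.subset_closure (.inr ⟨k, rfl⟩)
  have hHR : H ≤ Subring.closure s := fun f hf => Subring.subset_closure (.inl hf)
  have hR : ∀ f ∈ Subring.closure s, f ≠ 0 → f * f⁻¹ = 1 := by
    intro f hf h0
    obtain ⟨n, hn⟩ := exists_mem_adjoinSegment hf
    exact (nonzeroComparable_adjoinSegment h2 hpow
      (fun k => nonzeroComparable_of_isField hH.isField (hle k)) n 0 f hn h0).mul_inv_cancel
  have hd : ∀ f ∈ s, ∃ f' ∈ Subring.closure s, GermHasDeriv f f' := by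
    rintro f (hf | ⟨k, rfl⟩)
    · obtain ⟨f', hf', hfd⟩ := hH.exists_deriv f hf
      exact ⟨f', hHR hf', hfd⟩
    -- The derivative of `y k` involves `y (k + 1)`, hence the whole infinite chain is adjoined at
    -- once.
    · exact ⟨_, mul_mem (hyR k) (hyR (k + 1)), y k, y k * y (k + 1), rfl, rfl, hderiv k⟩
  exact ⟨_, isHardyField_fractionSubring hR (exists_deriv_mem_closure hd),
    hHR.trans (le_fractionSubring hR), fun k => le_fractionSubring hR (hyR k)⟩

/-! ### Construction of a chain of logarithmic derivatives. -/

/-- The solution of `u' = u²` on `(-∞, k + 1]` with value `b` at `k + 1`, extended by the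
constant `b`. -/
noncomputable def seed (b : ℕ → ℝ) (k : ℕ) (x : ℝ) : ℝ :=
  ((b k)⁻¹ + max 0 (k + 1 - x))⁻¹

/-- Approximations to a chain of successive logarithmic derivatives: `chainApprox b n k` equals
`seed b k` up to `k + 1`, and has logarithmic derivative `chainApprox b (n - 1) (k + 1)` after. -/
noncomputable def chainApprox (b : ℕ → ℝ) : ℕ → ℕ → ℝ → ℝ
  | 0, k => seed b k
  | n + 1, k => fun x =>
      seed b k x * Real.exp (∫ t in (k + 1 : ℝ)..max x (k + 1), chainApprox b n (k + 1) t)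

/-- The limit of the functions `chainApprox b n k` for `n → ∞`. -/
noncomputable def chain (b : ℕ → ℝ) (k : ℕ) (x : ℝ) : ℝ :=
  chainApprox b ⌈x⌉₊ k x

section
variable {b : ℕ → ℝ}

theorem seed_denom_pos (hb : ∀ k, 2 ≤ b k) (k : ℕ) (x : ℝ) :
    0 < (b k)⁻¹ + max 0 (k + 1 - x) := by
  have : 0 < (b k)⁻¹ := inv_pos.2 (by linarith [hb k])
  have := le_max_left 0 (k + 1 - x)
  linarith

theorem seed_pos (hb : ∀ k, 2 ≤ b k) (k : ℕ) (x : ℝ) : 0 < seed b k x :=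
  inv_pos.2 (seed_denom_pos hb k x)

theorem continuous_seed (hb : ∀ k, 2 ≤ b k) (k : ℕ) : Continuous (seed b k) := by
  unfold seed
  exact Continuous.inv₀ (by fun_prop) fun x => (seed_denom_pos hb k x).ne'

theorem seed_of_le {k : ℕ} {x : ℝ} (hx : k + 1 ≤ x) : seed b k x = b k := by
  rw [seed, max_eq_left (by linarith), add_zero, inv_inv]

theorem seed_natCast_le_one (hb : ∀ k, 2 ≤ b k) (k : ℕ) : seed b k k ≤ 1 := by
  have : 0 < (b k)⁻¹ := inv_pos.2 (by linarith [hb k])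
  rw [seed]
  refine inv_le_one_of_one_le₀ ?_
  have := le_max_right 0 ((k : ℝ) + 1 - k)
  linarith

/-- The equation `u' = u²` says that `u` is its own logarithmic derivative. -/
theorem seed_eq_mul_exp (hb : ∀ k, 2 ≤ b k) {k : ℕ} {a x : ℝ} (ha : a ≤ x) (hx : x ≤ k + 1) :
    seed b k x = seed b k a * Real.exp (∫ t in a..x, seed b k t) := by
  have hε : 0 < (b k)⁻¹ := inv_pos.2 (by linarith [hb k])
  have heq : ∀ t, t ≤ (k : ℝ) + 1 → seed b k t = ((b k)⁻¹ + (k + 1 - t))⁻¹ := fun t ht => by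
    rw [seed, max_eq_right (by linarith)]
  have hlog : ∫ t in a..x, seed b k t =
      -Real.log ((b k)⁻¹ + (k + 1 - x)) - -Real.log ((b k)⁻¹ + (k + 1 - a)) := by
    refine intervalIntegral.integral_eq_sub_of_hasDerivAt
      (f := fun t => -Real.log ((b k)⁻¹ + (k + 1 - t))) (fun t ht => ?_)
      ((continuous_seed hb k).intervalIntegrable _ _)
    rw [Set.uIcc_of_le ha] at ht
    have h1 : HasDerivAt (fun t : ℝ => (b k)⁻¹ + (k + 1 - t)) (-1) t :=
      ((hasDerivAt_id t).const_sub _).const_add _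
    have h2 := (h1.log (by linarith [ht.2] : (0 : ℝ) < (b k)⁻¹ + (k + 1 - t)).ne').neg
    rw [heq t (by linarith [ht.2])]
    rwa [neg_div, neg_neg, one_div] at h2
  have hpx : 0 < (b k)⁻¹ + (k + 1 - x) := by linarith
  have hpa : 0 < (b k)⁻¹ + (k + 1 - a) := by linarith
  rw [hlog, heq x hx, heq a (by linarith), sub_neg_eq_add, Real.exp_add, Real.exp_neg,
    Real.exp_log hpx, Real.exp_log hpa, mul_comm ((b k)⁻¹ + (k + 1 - x))⁻¹,
    inv_mul_cancel_left₀ hpa.ne']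

theorem chainApprox_succ (n k : ℕ) (x : ℝ) : chainApprox b (n + 1) k x =
    seed b k x * Real.exp (∫ t in (k + 1 : ℝ)..max x (k + 1), chainApprox b n (k + 1) t) := rfl

theorem continuous_chainApprox (hb : ∀ k, 2 ≤ b k) (n : ℕ) :
    ∀ k, Continuous (chainApprox b n k) := by
  induction n with
  | zero => exact continuous_seed hb
  | succ n ih =>
    intro k
    refine (continuous_seed hb k).mul (Real.continuous_exp.comp ?_)
    exact (intervalIntegral.continuous_primitive
      (fun _ _ => (ih (k + 1)).intervalIntegrable _ _) _).comp (by fun_prop)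

/-- The two depths differ only by the innermost exponential, whose integral starts at `k + n + 1`
and is empty before that point. -/
theorem chainApprox_succ_eq (n : ℕ) :
    ∀ (k : ℕ) (x : ℝ), x ≤ k + n + 1 → chainApprox b (n + 1) k x = chainApprox b n k x := by
  induction n with
  | zero =>
    intro k x hx
    rw [chainApprox_succ, max_eq_right (by simpa using hx)]
    simp [chainApprox]
  | succ n ih =>
    intro k x hx
    rw [chainApprox_succ, chainApprox_succ]
    congr 2
    refine intervalIntegral.integral_congr fun t ht => ih (k + 1) t ?_
    rw [Set.uIcc_of_le (le_max_right _ _)] at ht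
    refine ht.2.trans (max_le ?_ ?_) <;> push_cast at hx ⊢
    · linarith
    · linarith [(Nat.cast_nonneg n : (0 : ℝ) ≤ n)]

theorem chain_eq_chainApprox {k n : ℕ} {x : ℝ} (hx : x ≤ n) :
    chain b k x = chainApprox b n k x := by
  have h : ∀ m, ⌈x⌉₊ ≤ m → chainApprox b m k x = chain b k x := fun m hm => by
    induction m, hm using Nat.le_induction with
    | base => rfl
    | succ m hm ih =>
      rw [← ih]
      have : x ≤ m := Nat.ceil_le.1 hm
      exact chainApprox_succ_eq m k x (by linarith [(Nat.cast_nonneg k : (0 : ℝ) ≤ k)])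
  exact (h n (Nat.ceil_le.2 hx)).symm

theorem continuous_chain (hb : ∀ k, 2 ≤ b k) (k : ℕ) : Continuous (chain b k) := by
  refine continuous_iff_continuousAt.2 fun x => ?_
  obtain ⟨n, hn⟩ := exists_nat_gt x
  refine (continuous_chainApprox hb n k).continuousAt.congr ?_
  filter_upwards [Iio_mem_nhds hn] with t ht
  exact (chain_eq_chainApprox (le_of_lt ht)).symm

theorem chain_of_le {k : ℕ} {x : ℝ} (hx : x ≤ k + 1) : chain b k x = seed b k x := by
  rw [chain_eq_chainApprox (n := k + 1) (by exact_mod_cast hx), chainApprox_succ,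
    max_eq_right hx]
  simp

theorem chain_of_ge {k : ℕ} {x : ℝ} (hx : k + 1 ≤ x) :
    chain b k x = b k * Real.exp (∫ t in (k + 1 : ℝ)..x, chain b (k + 1) t) := by
  obtain ⟨n, hn⟩ := exists_nat_ge x
  rw [chain_eq_chainApprox (n := n + 1) (by push_cast; linarith), chainApprox_succ,
    max_eq_left hx, seed_of_le hx]
  congr 2
  refine intervalIntegral.integral_congr fun t ht => ?_
  rw [Set.uIcc_of_le hx] at ht
  exact (chain_eq_chainApprox (ht.2.trans hn)).symm

theorem chain_pos (hb : ∀ k, 2 ≤ b k) (k : ℕ) (x : ℝ) : 0 < chain b k x := by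
  rcases le_total x (k + 1) with hx | hx
  · rw [chain_of_le hx]
    exact seed_pos hb k x
  · rw [chain_of_ge hx]
    have := hb k
    positivity

theorem chain_eq_mul_exp (hb : ∀ k, 2 ≤ b k) {k : ℕ} {a x : ℝ} (ha : k + 1 ≤ a) (hx : a ≤ x) :
    chain b k x = chain b k a * Real.exp (∫ t in a..x, chain b (k + 1) t) := by
  have hi := fun u v => (continuous_chain hb (k + 1)).intervalIntegrable
    (μ := MeasureTheory.volume) u v
  rw [chain_of_ge (ha.trans hx), chain_of_ge ha, mul_assoc, ← Real.exp_add,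
    intervalIntegral.integral_add_adjacent_intervals (hi _ _) (hi _ _)]

theorem hasDerivAt_chain (hb : ∀ k, 2 ≤ b k) {k : ℕ} {x : ℝ} (hx : k + 1 < x) :
    HasDerivAt (chain b k) (chain b k x * chain b (k + 1) x) x := by
  have h1 : HasDerivAt (fun x => ∫ t in (k + 1 : ℝ)..x, chain b (k + 1) t)
      (chain b (k + 1) x) x :=
    ((continuous_chain hb (k + 1)).integral_hasStrictDerivAt _ x).hasDerivAt
  have h2 := (h1.exp.const_mul (b k)).congr_of_eventuallyEq (f₁ := chain b k) (by
    filter_upwards [Ioi_mem_nhds hx] with t ht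
    exact chain_of_ge (le_of_lt ht))
  rwa [← mul_assoc, ← chain_of_ge hx.le] at h2

/-! ### Growth of the chain. -/

theorem integral_chain_mono (hb : ∀ k, 2 ≤ b k) {f : ℝ → ℝ} (hf : Continuous f) {k : ℕ} {a x : ℝ}
    (hx : a ≤ x) (h : ∀ t ∈ Set.Icc a x, f t ≤ chain b k t) :
    ∫ t in a..x, f t ≤ ∫ t in a..x, chain b k t :=
  intervalIntegral.integral_mono_on hx (hf.intervalIntegrable _ _)
    ((continuous_chain hb k).intervalIntegrable _ _) h

/-- Here both functions have logarithmic derivative `seed b (k + 1)`, so their ratio is constant. At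
`k + 1` it is `b k ≥ 2` divided by a seed value at most `1`; this is the purpose of the seeds. -/
theorem two_mul_chain_succ_le_of_le (hb : ∀ k, 2 ≤ b k) {k : ℕ} {x : ℝ} (h1 : k + 1 ≤ x)
    (h2 : x ≤ k + 2) : 2 * chain b (k + 1) x ≤ chain b k x := by
  have hk : x ≤ ((k + 1 : ℕ) : ℝ) + 1 := by push_cast; linarith
  have hint : ∫ t in (k + 1 : ℝ)..x, chain b (k + 1) t =
      ∫ t in (k + 1 : ℝ)..x, seed b (k + 1) t := by
    refine intervalIntegral.integral_congr fun t ht => ?_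
    rw [Set.uIcc_of_le h1] at ht
    exact chain_of_le (ht.2.trans hk)
  rw [chain_of_ge h1, chain_of_le hk, seed_eq_mul_exp hb h1 hk, hint, ← mul_assoc]
  refine mul_le_mul_of_nonneg_right ?_ (Real.exp_pos _).le
  have := seed_natCast_le_one hb (k + 1)
  push_cast at this
  linarith [hb k]

theorem two_mul_chain_succ_le (hb : ∀ k, 2 ≤ b k) {k : ℕ} {x : ℝ} (hx : k + 1 ≤ x) :
    2 * chain b (k + 1) x ≤ chain b k x := by
  -- Induction on the length of the interval, for all `k` at once. Past `k + 2` the ratio does not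
  -- decrease, because the logarithmic derivatives satisfy `chain b (k + 2) ≤ chain b (k + 1)`,
  -- which is the claim for `k + 1` on an interval shorter by one.
  suffices H : ∀ (n k : ℕ) (x : ℝ), k + 1 ≤ x → x ≤ k + 1 + n →
      2 * chain b (k + 1) x ≤ chain b k x by
    obtain ⟨n, hn⟩ := exists_nat_ge (x - (k + 1))
    exact H n k x hx (by linarith)
  intro n
  induction n with
  | zero => exact fun k x h1 h2 => two_mul_chain_succ_le_of_le hb h1 (by simp at h2; linarith)
  | succ n ih =>
    intro k x h1 h2
    push_cast at h2
    rcases le_total x (k + 2) with hx | hx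
    · exact two_mul_chain_succ_le_of_le hb h1 hx
    · have h0 : 2 * chain b (k + 1) (k + 2) ≤ chain b k (k + 2) :=
        two_mul_chain_succ_le_of_le hb (by linarith) le_rfl
      have hmono := integral_chain_mono hb (continuous_chain hb (k + 2)) (k := k + 1) hx
        fun t ht => by
          have := ih (k + 1) t (by push_cast; linarith [ht.1]) (by push_cast; linarith [ht.2])
          linarith [chain_pos hb (k + 2) t]
      rw [chain_eq_mul_exp hb (k := k) (a := k + 2) (by linarith) hx,
        chain_eq_mul_exp hb (k := k + 1) (a := k + 2) (by push_cast; linarith) hx, ← mul_assoc]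
      have := chain_pos hb k (k + 2)
      gcongr

/-- From `m + 1` on, `chain b m` is at least its starting value `b m`, and lowering the index only
increases the function. So one choice of `b m` controls all `k ≤ m`. -/
theorem le_chain (hb : ∀ k, 2 ≤ b k) {k m : ℕ} (hkm : k ≤ m) {x : ℝ} (hx : m + 1 ≤ x) :
    b m ≤ chain b k x := by
  induction hkm using Nat.decreasingInduction with
  | self =>
    rw [chain_of_ge hx]
    refine le_mul_of_one_le_right (by linarith [hb m]) (Real.one_le_exp ?_)
    exact intervalIntegral.integral_nonneg hx fun t _ => (chain_pos hb _ t).le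
  | of_succ k hk ih =>
    have hk' : (k : ℝ) ≤ m := by exact_mod_cast hk.le
    have := two_mul_chain_succ_le hb (k := k) (x := x) (by linarith)
    linarith [chain_pos hb (k + 1) x]

theorem eventually_two_le_chain (hb : ∀ k, 2 ≤ b k) (k : ℕ) :
    ∀ᶠ x in atTop, 2 ≤ chain b k x := by
  filter_upwards [eventually_ge_atTop (k + 1 : ℝ)] with x hx
  exact (hb k).trans (le_chain hb le_rfl hx)

/-- The logarithmic derivatives differ by at least `1`, as `chain b (k + 1) ≥ 2 * chain b (k + 2)`
and `chain b (k + 2) ≥ 2`; so the ratio grows at least like `exp x`. -/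
theorem eventually_mul_chain_succ_le (hb : ∀ k, 2 ≤ b k) (k : ℕ) (M : ℝ) :
    ∀ᶠ x in atTop, M * chain b (k + 1) x ≤ chain b k x := by
  -- From this point on, `le_chain` gives `chain b (k + 2) ≥ b (k + 2)`.
  set a : ℝ := k + 3 with ha
  have hexp : ∀ᶠ x in atTop, M ≤ Real.exp (x - a) :=
    (Real.tendsto_exp_atTop.comp (tendsto_atTop_add_const_right _ (-a) tendsto_id)).eventually
      (eventually_ge_atTop M)
  filter_upwards [hexp, eventually_ge_atTop a] with x hM hx
  have hi := (continuous_chain hb (k + 2)).intervalIntegrable (μ := MeasureTheory.volume) a x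
  have hmono := integral_chain_mono hb (f := fun t => chain b (k + 2) t + 1)
    ((continuous_chain hb (k + 2)).add continuous_const) (k := k + 1) hx fun t ht => by
      have h1 := two_mul_chain_succ_le hb (k := k + 1) (x := t) (by push_cast; linarith [ht.1])
      have h2 := le_chain hb (le_refl (k + 2)) (x := t) (by push_cast; linarith [ht.1])
      linarith [hb (k + 2)]
  rw [intervalIntegral.integral_add hi (by simp), intervalIntegral.integral_const,
    smul_eq_mul, mul_one] at hmono
  have hpos := chain_pos hb (k + 1) a
  have h0 : chain b (k + 1) a ≤ chain b k a := by
    linarith [two_mul_chain_succ_le hb (k := k) (x := a) (by linarith)]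
  calc M * chain b (k + 1) x
      ≤ Real.exp (x - a) * chain b (k + 1) x :=
        mul_le_mul_of_nonneg_right hM (chain_pos hb _ _).le
    _ = chain b (k + 1) a * Real.exp ((∫ t in a..x, chain b (k + 2) t) + (x - a)) := by
        rw [chain_eq_mul_exp hb (k := k + 1) (a := a) (by push_cast; linarith) hx, Real.exp_add]
        ring
    _ ≤ chain b k a * Real.exp (∫ t in a..x, chain b (k + 1) t) := by
        have := chain_pos hb k a
        gcongr
    _ = chain b k x := (chain_eq_mul_exp hb (by linarith) hx).symm

/-- The logarithmic derivative of the power is `m * chain b (k + 2)`, eventually at most that of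
`chain b k`; integration costs only a constant. -/
theorem exists_mul_chain_succ_pow_le (hb : ∀ k, 2 ≤ b k) (k m : ℕ) :
    ∃ C > 0, ∀ᶠ x in atTop, C * chain b (k + 1) x ^ m ≤ chain b k x := by
  obtain ⟨a, ha⟩ := eventually_atTop.1 ((eventually_mul_chain_succ_le hb (k + 1) m).and
    (eventually_ge_atTop (k + 2 : ℝ)))
  have hka := (ha a le_rfl).2
  have hpk := chain_pos hb k a
  have hpk1 := chain_pos hb (k + 1) a
  refine ⟨chain b k a / chain b (k + 1) a ^ m, by positivity, ?_⟩
  filter_upwards [eventually_ge_atTop a] with x hx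
  have hmono := integral_chain_mono hb (f := fun t => m * chain b (k + 2) t)
    (continuous_const.mul (continuous_chain hb (k + 2))) (k := k + 1) hx
    fun t ht => (ha t ht.1).1
  rw [intervalIntegral.integral_const_mul] at hmono
  rw [chain_eq_mul_exp hb (k := k) (a := a) (by linarith) hx,
    chain_eq_mul_exp hb (k := k + 1) (a := a) (by push_cast; linarith) hx, mul_pow,
    ← Real.exp_nat_mul, ← mul_assoc, div_mul_cancel₀ _ (by positivity)]
  gcongr

theorem eventually_chain_succ_pow_le (hb : ∀ k, 2 ≤ b k) (k m : ℕ) :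
    ∀ᶠ x in atTop, chain b (k + 1) x ^ m ≤ chain b k x := by
  -- The extra factor `chain b (k + 1)` eventually exceeds `C⁻¹` and absorbs the constant.
  obtain ⟨C, hC, h⟩ := exists_mul_chain_succ_pow_le hb k (m + 1)
  filter_upwards [h, eventually_mul_chain_succ_le hb (k + 1) C⁻¹,
    eventually_two_le_chain hb (k + 2)] with x h1 h2 h3
  refine le_trans ?_ h1
  have hC' : 0 < C⁻¹ := inv_pos.2 hC
  have h4 : 1 ≤ C * chain b (k + 1) x := by
    rw [← mul_inv_cancel₀ hC.ne']
    refine mul_le_mul_of_nonneg_left (le_trans ?_ h2) hC.le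
    exact le_mul_of_one_le_right hC'.le (by linarith)
  rw [pow_succ', ← mul_assoc]
  exact le_mul_of_one_le_left (pow_nonneg (chain_pos hb _ _).le _) h4

end

/-! ### Domination and uncountable cofinality. -/

/-- Countably many eventually continuous functions are bounded on `[m + 1, m + 2]`, at least those
among the first `m` that are continuous there. -/
theorem exists_bound_of_continuousOn (f : ℕ → ℝ → ℝ) (a : ℕ → ℝ)
    (hf : ∀ n, ∀ t, a n ≤ t → ContinuousAt (f n) t) (m : ℕ) :
    ∃ B : ℝ, 2 ≤ B ∧ ∀ n ≤ m, a n ≤ m + 1 → ∀ t ∈ Set.Icc (m + 1 : ℝ) (m + 2), f n t ≤ B := by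
  have h : ∀ n, ∃ B : ℝ, a n ≤ m + 1 → ∀ t ∈ Set.Icc (m + 1 : ℝ) (m + 2), f n t ≤ B := by
    intro n
    by_cases hn : a n ≤ m + 1
    · obtain ⟨B, hB⟩ := (isCompact_Icc (a := (m + 1 : ℝ)) (b := m + 2)).bddAbove_image
        (f := f n) fun t ht => (hf n t (hn.trans ht.1)).continuousWithinAt
      exact ⟨B, fun _ t ht => hB ⟨t, ht, rfl⟩⟩
    · exact ⟨0, fun h => absurd h hn⟩
  choose B hB using h
  obtain ⟨M, hM⟩ := ((Finset.range (m + 1)).image B).bddAbove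
  refine ⟨max 2 M, le_max_left _ _, fun n hn ha t ht => (hB n ha t ht).trans ?_⟩
  exact (hM (by simpa using ⟨n, by omega, rfl⟩)).trans (le_max_right _ _)

/-- The functions `chain b k` can be made to dominate countably many eventually continuous
functions. -/
theorem exists_chain_dominating (f : ℕ → ℝ → ℝ)
    (hf : ∀ n, ∀ᶠ t in atTop, ContinuousAt (f n) t) :
    ∃ b : ℕ → ℝ, (∀ k, 2 ≤ b k) ∧ ∀ k n, ∀ᶠ t in atTop, f n t ≤ chain b k t := by
  choose a ha using fun n => eventually_atTop.1 (hf n)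
  choose b hb hbf using exists_bound_of_continuousOn f a ha
  refine ⟨b, hb, fun k n => ?_⟩
  filter_upwards [eventually_ge_atTop (k + 1 : ℝ), eventually_ge_atTop (n + 1 : ℝ),
    eventually_ge_atTop (a n + 1)] with t hk hn hat
  have ht : 0 ≤ t - 1 := by linarith [(Nat.cast_nonneg k : (0 : ℝ) ≤ k)]
  have h1 := Nat.floor_le ht
  have h2 := Nat.lt_floor_add_one (t - 1)
  -- For `m = ⌊t - 1⌋₊` the point `t` lies in `[m + 1, m + 2]`, and `m ≥ n, k`; hence `f n t ≤ b m ≤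
  -- chain b k t`.
  refine (hbf ⌊t - 1⌋₊ n (Nat.le_floor (by linarith)) (by linarith) t
    ⟨by linarith, by linarith⟩).trans ?_
  exact le_chain hb (Nat.le_floor (by linarith)) (by linarith)

/-- A Hardy field with a countable cofinal subset has a Hardy field extension with an element
above all its elements. -/
theorem exists_isHardyField_above {H : Subring GermsAtInfinity} (hH : IsHardyField H)
    (f : ℕ → H) (hf : ∀ x : H, ∃ n, x ≤ f n) :
    ∃ K, IsHardyField K ∧ H ≤ K ∧ ∃ y ∈ K, ∀ x ∈ H, x ≤ y := by
  have hrep : ∀ n, ∃ g : ℝ → ℝ, (f n : GermsAtInfinity) = (g : GermsAtInfinity) ∧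
      ∀ᶠ t in atTop, ContinuousAt g t := fun n => by
    obtain ⟨_, _, g, g', hg, _, hd⟩ := hH.exists_deriv _ (f n).2
    exact ⟨g, hg, hd.mono fun t h => h.continuousAt⟩
  choose g hg hc using hrep
  obtain ⟨b, hb, hbg⟩ := exists_chain_dominating g hc
  have hle : ∀ k, ∀ x ∈ H, x ≤ (chain b k : GermsAtInfinity) := fun k x hx => by
    obtain ⟨n, hn⟩ := hf ⟨x, hx⟩
    have hn' : x ≤ (f n : GermsAtInfinity) := hn
    rw [hg] at hn'
    exact hn'.trans (Germ.coe_le.2 (hbg k n))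
  obtain ⟨K, hK, hHK, hy⟩ := exists_isHardyField_of_logDeriv_chain hH
    (eventually_two_le_chain hb) (eventually_chain_succ_pow_le hb)
    (fun k => by
      filter_upwards [eventually_gt_atTop (k + 1 : ℝ)] with t ht using hasDerivAt_chain hb ht) hle
  exact ⟨K, hK, hHK, _, hy 0, hle 0⟩

theorem germ_not_add_one_le (f : GermsAtInfinity) : ¬ f + 1 ≤ f := by
  induction f using Germ.inductionOn with | _ f => ?_
  intro h
  rw [← Germ.coe_one, ← Germ.coe_add, Germ.coe_le] at h
  obtain ⟨t, ht⟩ := h.exists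
  simp at ht
  linarith

theorem aleph0_lt_cof_of_maximal {H : Subring GermsAtInfinity} (hH : Maximal IsHardyField H) :
    ℵ₀ < Order.cof H := by
  by_contra! hcof
  obtain ⟨s, hs, hcard⟩ := Order.exists_cof_eq (α := H)
  have hscount : s.Countable := by rwa [← Cardinal.le_aleph0_iff_set_countable, hcard]
  have hne : s.Nonempty := by
    obtain ⟨x, hx, _⟩ := hs 0
    exact ⟨x, hx⟩
  obtain ⟨f, rfl⟩ := hscount.exists_eq_range hne
  obtain ⟨K, hK, hHK, y, hy, hle⟩ := exists_isHardyField_above hH.prop f fun x => by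
    obtain ⟨_, ⟨n, rfl⟩, hn⟩ := hs x
    exact ⟨n, hn⟩
  exact germ_not_add_one_le y (hle _ (add_mem (hH.le_of_ge hK hHK hy) (one_mem H)))

/-! ### Symmetries of the order. -/

/-- Taking reciprocals is an order reversing bijection of the positive elements of a field of
germs. -/
theorem exists_orderIso_inv {H : Subring GermsAtInfinity} (hH : IsField H) :
    Nonempty ((Set.Ioi (0 : H))ᵒᵈ ≃o Set.Ioi (0 : H)) := by
  -- The inverse of `x` in `H` is necessarily the germ of the pointwise inverse.
  have hpos : ∀ x : H, 0 < x → ∃ y : H, 0 < y ∧ (y : GermsAtInfinity) = (x : GermsAtInfinity)⁻¹ := by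
    rintro ⟨x, hx⟩ h
    obtain ⟨⟨y, hy⟩, hxy⟩ := hH.mul_inv_cancel h.ne'
    replace hxy : x * y = 1 := congrArg Subtype.val hxy
    replace h : 0 ≤ x := h.le
    induction x using Germ.inductionOn with | _ x => ?_
    induction y using Germ.inductionOn with | _ y => ?_
    have hyx : (y : GermsAtInfinity) = (x : GermsAtInfinity)⁻¹ := by
      rw [← Germ.coe_inv, Germ.coe_eq]
      rw [← Germ.coe_mul, ← Germ.coe_one, Germ.coe_eq] at hxy
      filter_upwards [hxy] with t ht
      exact eq_inv_of_mul_eq_one_right ht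
    refine ⟨⟨y, hy⟩, lt_of_le_of_ne ?_ ?_, hyx⟩
    · change (0 : GermsAtInfinity) ≤ y
      rw [hyx]
      rw [← Germ.coe_zero, Germ.coe_le] at h
      rw [← Germ.coe_zero, ← Germ.coe_inv, Germ.coe_le]
      filter_upwards [h] with t ht
      exact inv_nonneg.2 ht
    · intro h0
      have hy0 : (0 : GermsAtInfinity) = y := congrArg Subtype.val h0
      rw [← hy0, mul_zero] at hxy
      exact zero_ne_one hxy
  have hanti : ∀ x y z w : H, 0 < x → 0 < y → (z : GermsAtInfinity) = (x : GermsAtInfinity)⁻¹ →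
      (w : GermsAtInfinity) = (y : GermsAtInfinity)⁻¹ → x ≤ y → w ≤ z := by
    rintro ⟨x, hx⟩ ⟨y, hy⟩ z w h0x h0y hz hw hxy
    change (w : GermsAtInfinity) ≤ z
    obtain ⟨⟨u, hu⟩, hxu⟩ := hH.mul_inv_cancel h0x.ne'
    replace hxu : x * u = 1 := congrArg Subtype.val hxu
    rw [hw, hz]
    replace h0x : 0 ≤ x := h0x.le
    replace hxy : x ≤ y := hxy
    clear hw hz h0y
    induction x using Germ.inductionOn with | _ x => ?_
    induction y using Germ.inductionOn with | _ y => ?_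
    induction u using Germ.inductionOn with | _ u => ?_
    rw [← Germ.coe_zero, Germ.coe_le] at h0x
    rw [Germ.coe_le] at hxy
    rw [← Germ.coe_mul, ← Germ.coe_one, Germ.coe_eq] at hxu
    rw [← Germ.coe_inv, ← Germ.coe_inv, Germ.coe_le]
    filter_upwards [h0x, hxy, hxu] with t h1 h2 h3
    have : x t ≠ 0 := fun h => by
      simp [h] at h3
    exact inv_anti₀ (lt_of_le_of_ne h1 this.symm) h2
  choose! i hi hinv using hpos
  have hii : ∀ x, 0 < x → i (i x) = x := fun x hx =>
    Subtype.ext (by rw [hinv _ (hi x hx), hinv x hx, inv_inv])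
  refine ⟨⟨⟨fun x => ⟨i x.1, hi _ x.2⟩, fun x => ⟨i x.1, hi _ x.2⟩, fun x => ?_, fun x => ?_⟩, ?_⟩⟩
  · exact Subtype.ext (hii _ x.2)
  · exact Subtype.ext (hii _ x.2)
  · rintro ⟨x, hx⟩ ⟨y, hy⟩
    change i x ≤ i y ↔ y ≤ x
    refine ⟨fun h => ?_, fun h => hanti y x _ _ hy hx (hinv y hy) (hinv x hx) h⟩
    have := hanti _ _ _ _ (hi x hx) (hi y hy) (hinv _ (hi x hx)) (hinv _ (hi y hy)) h
    rwa [hii x hx, hii y hy] at this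

/-- The bound `x² + 1` avoids comparing `x` with `0`: the order on germs is only partial, and
totality on `H` is never invoked. -/
theorem exists_pos_ge {H : Subring GermsAtInfinity} (x : H) : ∃ y : H, 0 < y ∧ x ≤ y := by
  obtain ⟨x, hx⟩ := x
  have key : (0 : GermsAtInfinity) ≤ x * x ∧ x ≤ x * x + 1 := by
    clear hx
    induction x using Germ.inductionOn with | _ x => ?_
    rw [← Germ.coe_zero, ← Germ.coe_mul, ← Germ.coe_one, ← Germ.coe_add, Germ.coe_le, Germ.coe_le]
    refine ⟨.of_forall fun t => mul_self_nonneg (x t), .of_forall fun t => ?_⟩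
    simp only [Pi.add_apply, Pi.mul_apply, Pi.one_apply]
    nlinarith [sq_nonneg (x t - 1)]
  have h1 : (0 : GermsAtInfinity) + 1 ≤ x * x + 1 := add_le_add_left key.1 1
  have h01 : (0 : GermsAtInfinity) ≤ 0 + 1 := by
    rw [← Germ.coe_zero, ← Germ.coe_one, ← Germ.coe_add, Germ.coe_le]
    exact .of_forall fun t => by simp
  exact ⟨⟨x * x + 1, add_mem (mul_mem hx hx) (one_mem H)⟩,
    lt_of_le_not_ge (h01.trans h1) fun h => germ_not_add_one_le 0 (h1.trans h), key.2⟩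

theorem cof_Ioi_zero (H : Subring GermsAtInfinity) : Order.cof (Set.Ioi (0 : H)) = Order.cof H := by
  choose r hr hxr using fun x : H => exists_pos_ge x
  apply le_antisymm
  · obtain ⟨s, hs, hcard⟩ := Order.exists_cof_eq (α := H)
    rw [← hcard]
    refine (Order.cof_le (s := (fun x => ⟨r x, hr x⟩ : H → Set.Ioi (0 : H)) '' s)
      fun y => ?_).trans Cardinal.mk_image_le
    obtain ⟨x, hx, hyx⟩ := hs y
    exact ⟨_, ⟨x, hx, rfl⟩, hyx.trans (hxr x)⟩
  · obtain ⟨s, hs, hcard⟩ := Order.exists_cof_eq (α := Set.Ioi (0 : H))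
    rw [← hcard]
    refine (Order.cof_le (s := Subtype.val '' s) fun x => ?_).trans Cardinal.mk_image_le
    obtain ⟨y, hy, hxy⟩ := hs ⟨r x, hr x⟩
    exact ⟨_, ⟨y, hy, rfl⟩, (hxr x).trans hxy⟩

theorem mainTheorem11 (H : Subring GermsAtInfinity) (hH : Maximal IsHardyField H) :
    ℵ₀ < Order.cof H ∧
      ∀ a : H, coinitiality H = Order.cof (Set.Iio a) ∧
        Order.cof (Set.Iio a) = coinitiality (Set.Ioi a) ∧
        ℵ₀ < coinitiality (Set.Ioi a) := by
  have hcof := aleph0_lt_cof_of_maximal hH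
  obtain ⟨inv⟩ := exists_orderIso_inv hH.prop.isField
  have : IsOrderedAddMonoid H := ⟨fun a b h c => add_le_add_left (α := GermsAtInfinity) h c,
    fun a b h c => add_le_add_right (α := GermsAtInfinity) h c⟩
  have hpos : Order.cof (Set.Ioi (0 : H))ᵒᵈ = Order.cof H :=
    inv.cof_congr.trans (cof_Ioi_zero H)
  have hneg : coinitiality H = Order.cof H := (OrderIso.neg H).cof_congr.symm
  refine ⟨hcof, fun a => ?_⟩
  -- The reflection `x ↦ a - x` carries the elements below `a` to the positive ones, reversing the
  -- order; for those above `a` the translation `x ↦ x - a` preserves it.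
  have hIio : Order.cof (Set.Iio a) = Order.cof H := by
    rw [← hpos]
    refine OrderIso.cof_congr ⟨⟨fun x => OrderDual.toDual ⟨a - x.1, Set.mem_Ioi.2 (sub_pos.2 x.2)⟩,
      fun x => ⟨a - x.1, Set.mem_Iio.2 <| sub_lt_self a x.2⟩, fun x => ?_, fun x => ?_⟩, ?_⟩
    · exact Subtype.ext (sub_sub_cancel a x.1)
    · exact Subtype.ext (sub_sub_cancel a x.1)
    · exact sub_le_sub_iff_left a
  have hIoi : coinitiality (Set.Ioi a) = Order.cof H := by
    rw [← hpos]
    refine OrderIso.cof_congr (OrderIso.dual ⟨⟨fun x => ⟨x.1 - a, Set.mem_Ioi.2 (sub_pos.2 x.2)⟩,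
      fun x => ⟨x.1 + a, Set.mem_Ioi.2 <| lt_add_of_pos_left a x.2⟩, fun x => ?_, fun x => ?_⟩, ?_⟩)
    · exact Subtype.ext (sub_add_cancel x.1 a)
    · exact Subtype.ext (add_sub_cancel_right x.1 a)
    · exact sub_le_sub_iff_right a
  rw [hneg, hIio, hIoi]
  exact ⟨rfl, rfl, hcof⟩
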